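/- Let $Gl(n)^+$ be the set of positive definite matrices in $\mathcal{M}_n(\mathbb{C})$, and let $N$ be a unitarily invariant norm on $\mathcal{M}_n(\mathbb{C})$, that is, a norm with $N(UXV)=N(X)$ for all $X\in\mathcal{M}_n(\mathbb{C})$ and all unitary $U,V$. For a piecewise smooth curve $\alpha:[0,1]\to Gl(n)^+$ put $$L_N(\alpha)=\int_0^1 N\big(\alpha(t)^{-1/2}\,\dot\alpha(t)\,\alpha(t)^{-1/2}\big)\,dt ,$$ and for $A,B\in Gl(n)^+$ let $d_N(A,B)$ be the infimum of $L_N(\alpha)$ over all piecewise smooth curves $\alpha:[0,1]\to Gl(n)^+$ with $\alpha(0)=A$ and $\alpha(1)=B$. The geodesic of $Gl(n)^+$ joining $A$ to $B$ is $$\gamma_{A,B}(s)=A^{1/2}\big(A^{-1/2}BA^{-1/2}\big)^sA^{1/2},\qquad s\in[0,1],$$ and a set $S\subseteq Gl(n)^+$ is called geodesically convex if $\gamma_{W_0,W_1}(s)\in S$ for all $W_0,W_1\in S$ and $s\in[0,1]$. Then: 1. For all $A,B\in Gl(n)^+$ the map $[0,1]\ni s\mapsto d_N(I,\gamma_{A,B}(s))$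 is convex. 2. For all $P\in Gl(n)^+$ and $t\in(0,1)$ the set of intermediate points $$\mathcal{M}_t(I,P)=\{W\in Gl(n)^+ : d_N(I,W)=t\,d_N(I,P)\ \text{ and }\ d_N(W,P)=(1-t)\,d_N(I,P)\}$$ is geodesically convex. -/

import Mathlib

open Set
open scoped ContDiff ComplexOrder MatrixOrder Matrix.Norms.L2Operator

/-- A norm on the complex `n × n` matrices that is unitarily invariant: a seminorm over `ℂ` that is
definite and satisfies `N (U X V) = N X` for all unitary `U`, `V`. -/
structure IsUnitarilyInvariantNorm {n : ℕ} (N : Seminorm ℂ (Matrix (Fin n) (Fin n) ℂ)) :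
    Prop where
  eq_zero_of_map_eq_zero : ∀ X : Matrix (Fin n) (Fin n) ℂ, N X = 0 → X = 0
  map_unitary_mul_mul : ∀ U ∈ Matrix.unitaryGroup (Fin n) ℂ, ∀ V ∈ Matrix.unitaryGroup (Fin n) ℂ,
    ∀ X : Matrix (Fin n) (Fin n) ℂ, N (U * X * V) = N X

/-- `α`, restricted to `[0, 1]`, is a piecewise smooth curve in the space of positive definite
matrices, going from `A` to `B`. (Only the values of `α` on `[0, 1]` matter. All norms on matrices
are equivalent, so smoothness does not depend on the norm in force.) -/
structure IsPosCurve {n : ℕ} (A B : Matrix (Fin n) (Fin n) ℂ)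
    (α : ℝ → Matrix (Fin n) (Fin n) ℂ) : Prop where
  source : α 0 = A
  target : α 1 = B
  posDef : ∀ t ∈ Icc (0 : ℝ) 1, (α t).PosDef
  continuousOn : ContinuousOn α (Icc 0 1)
  piecewise_smooth : ∃ (k : ℕ) (τ : ℕ → ℝ), Monotone τ ∧ τ 0 = 0 ∧ τ k = 1 ∧
    ∀ i < k, ContDiffOn ℝ ∞ α (Icc (τ i) (τ (i + 1)))

/-- The length of `α : [0, 1] → Gl(n)⁺` for the Finsler metric which gives a tangent vector `X`
at `A` the norm `N (A^{-1/2} X A^{-1/2})`. The powers are those of the functional calculus. For a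
piecewise smooth `α` the derivative exists outside finitely many points. -/
noncomputable def finslerLength {n : ℕ} (N : Seminorm ℂ (Matrix (Fin n) (Fin n) ℂ))
    (α : ℝ → Matrix (Fin n) (Fin n) ℂ) : ℝ :=
  ∫ t in (0 : ℝ)..1, N (α t ^ (-(1 / 2) : ℝ) * deriv α t * α t ^ (-(1 / 2) : ℝ))

/-- The rectifiable distance `d_N` on positive definite matrices: the infimum of the lengths of the
piecewise smooth curves of positive definite matrices joining `A` and `B`. -/
noncomputable def finslerDist {n : ℕ} (N : Seminorm ℂ (Matrix (Fin n) (Fin n) ℂ))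
    (A B : Matrix (Fin n) (Fin n) ℂ) : ℝ :=
  sInf (finslerLength N '' {α | IsPosCurve A B α})

/-- The geodesic `γ(s) = A^{1/2} (A^{-1/2} B A^{-1/2})^s A^{1/2}` of `Gl(n)⁺` from `A` to `B`. -/
noncomputable def posGeodesic {n : ℕ} (A B : Matrix (Fin n) (Fin n) ℂ) (s : ℝ) :
    Matrix (Fin n) (Fin n) ℂ :=
  A ^ (1 / 2 : ℝ) * (A ^ (-(1 / 2) : ℝ) * B * A ^ (-(1 / 2) : ℝ)) ^ s * A ^ (1 / 2 : ℝ)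

/-- The set `M_t(A, B)` of intermediate points for the distance `d_N`. -/
def intermediatePoints {n : ℕ} (N : Seminorm ℂ (Matrix (Fin n) (Fin n) ℂ))
    (A B : Matrix (Fin n) (Fin n) ℂ) (t : ℝ) : Set (Matrix (Fin n) (Fin n) ℂ) :=
  {W | W.PosDef ∧ finslerDist N A W = t * finslerDist N A B ∧
    finslerDist N W B = (1 - t) * finslerDist N A B}

/-- A set of positive definite matrices is geodesically convex if it contains, with any two of its
points, the geodesic of `Gl(n)⁺` joining them. -/
def GeodesicallyConvex {n : ℕ} (S : Set (Matrix (Fin n) (Fin n) ℂ)) : Prop :=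
  (∀ W ∈ S, W.PosDef) ∧
    ∀ W₀ ∈ S, ∀ W₁ ∈ S, ∀ s ∈ Icc (0 : ℝ) 1, posGeodesic W₀ W₁ s ∈ S

/-! The core is the formula `finslerDist_eq`: d_N(A, B) = N(log(A^{-1/2} B A^{-1/2})). The geodesic
has exactly this length. For the converse, congruence by A^{-1/2} preserves lengths
(`finslerLength_conj`), so A = 1 may be assumed, and it suffices that N(log α) grows no faster than
the speed of α.

This growth bound is infinitesimal. In `IsUnitarilyInvariantNorm.map_log_le`, log C is normed by a
real functional that is diagonal in an eigenbasis of C. It exists because pinching to the diagonal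
does not increase N. Jensen's inequality for log and log x ≤ x - 1 then compare log C with log G up
to a second-order error, and a Dini derivative argument integrates the estimate.

The growth bound is also the triangle inequality through the point 1, and it yields convexity. If G
is the midpoint of X and Y, then G X⁻¹ G = Y, which makes X^{-1/2} G² X^{-1/2} unitarily conjugate
to Y. Hence 2 N(log G) = d_N(1, G²) ≤ d_N(1, X) + d_N(X, G²) = N(log X) + N(log Y). Continuity
upgrades midpoint convexity to convexity.

By congruence the distance to any P is convex along geodesics too, so closed balls are geodesically
convex. M_t(I, P) is the intersection of two balls whose radii add up to d_N(I, P). -/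

namespace Matrix

/-! ### Real powers, logarithms and congruences of positive definite matrices. -/

variable {n : ℕ} {A B : Matrix (Fin n) (Fin n) ℂ}

theorem PosDef.cfcRpow (hA : A.PosDef) (r : ℝ) : (A ^ r).PosDef :=
  isStrictlyPositive_iff_posDef.1 (IsStrictlyPositive.rpow A r hA.isStrictlyPositive)

theorem PosDef.cfcRpow_add (hA : A.PosDef) (r s : ℝ) : A ^ (r + s) = A ^ r * A ^ s :=
  CFC.rpow_add hA.isUnit

theorem PosDef.cfcRpow_zero (hA : A.PosDef) : A ^ (0 : ℝ) = 1 :=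
  CFC.rpow_zero A hA.isStrictlyPositive.nonneg

theorem PosDef.cfcRpow_one (hA : A.PosDef) : A ^ (1 : ℝ) = A :=
  CFC.rpow_one A hA.isStrictlyPositive.nonneg

theorem star_cfcRpow (r : ℝ) : star (A ^ r) = A ^ r :=
  (IsSelfAdjoint.of_nonneg CFC.rpow_nonneg).star_eq

theorem PosDef.cfcRpow_mul_cfcRpow_neg (hA : A.PosDef) (r : ℝ) : A ^ r * A ^ (-r) = 1 := by
  rw [← hA.cfcRpow_add, add_neg_cancel, hA.cfcRpow_zero]

theorem PosDef.cfcRpow_neg_mul_cfcRpow (hA : A.PosDef) (r : ℝ) : A ^ (-r) * A ^ r = 1 := by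
  rw [← hA.cfcRpow_add, neg_add_cancel, hA.cfcRpow_zero]

theorem PosDef.cfcRpow_half_mul_self (hA : A.PosDef) :
    A ^ (1 / 2 : ℝ) * A ^ (1 / 2 : ℝ) = A := by
  rw [← hA.cfcRpow_add, add_halves, hA.cfcRpow_one]

theorem PosDef.cfcRpow_neg_half_conj_self (hA : A.PosDef) :
    A ^ (-(1 / 2) : ℝ) * A * A ^ (-(1 / 2) : ℝ) = 1 := by
  nth_rewrite 2 [← hA.cfcRpow_one]
  rw [← hA.cfcRpow_add, ← hA.cfcRpow_add]
  norm_num [hA.cfcRpow_zero]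

theorem PosDef.pos_of_mem_spectrum (hA : A.PosDef) {x : ℝ} (hx : x ∈ spectrum ℝ A) : 0 < x :=
  hA.isStrictlyPositive.spectrum_pos hx

theorem PosDef.continuousOn_log_spectrum (hA : A.PosDef) :
    ContinuousOn Real.log (spectrum ℝ A) :=
  Real.continuousOn_log.mono fun _ hx => (hA.pos_of_mem_spectrum hx).ne'

theorem PosDef.log_cfcRpow (hA : A.PosDef) (r : ℝ) : CFC.log (A ^ r) = r • CFC.log A := by
  have hcont : ContinuousOn (fun x : ℝ => x ^ r) (spectrum ℝ A) := fun x hx =>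
    (Real.continuousAt_rpow_const x r (Or.inl (hA.pos_of_mem_spectrum hx).ne')).continuousWithinAt
  have hlog := hA.continuousOn_log_spectrum
  have hA' : IsSelfAdjoint A := hA.isHermitian
  rw [CFC.rpow_eq_cfc_real hA.isStrictlyPositive.nonneg, CFC.log, CFC.log,
    ← cfc_comp' Real.log (fun x : ℝ => x ^ r) A ?_ hcont, ← cfc_const_mul r Real.log A hlog]
  · exact cfc_congr fun x hx => Real.log_rpow (hA.pos_of_mem_spectrum hx) r
  · rintro _ ⟨x, hx, rfl⟩
    exact (Real.continuousAt_log
      (Real.rpow_pos_of_pos (hA.pos_of_mem_spectrum hx) r).ne').continuousWithinAt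

theorem PosDef.log_cfcRpow_neg_one (hA : A.PosDef) : CFC.log (A ^ (-1 : ℝ)) = -CFC.log A := by
  rw [hA.log_cfcRpow, neg_one_smul]

theorem PosDef.exp_smul_log (hA : A.PosDef) (t : ℝ) :
    A ^ t = NormedSpace.exp (t • CFC.log A) := by
  rw [← hA.log_cfcRpow, CFC.exp_log _ (hA.cfcRpow t).isStrictlyPositive]

theorem cfc_unitary_conj {U : Matrix (Fin n) (Fin n) ℂ} (hU : U ∈ unitaryGroup (Fin n) ℂ)
    (hA : IsSelfAdjoint A) (f : ℝ → ℝ) : cfc f (U * A * star U) = U * cfc f A * star U := by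
  have hcont : ContinuousOn f (spectrum ℝ A) := by
    have : (spectrum ℝ A).Finite := finite_real_spectrum
    exact this.continuousOn f
  have := StarAlgHomClass.map_cfc (S := ℂ) (Unitary.conjStarAlgAut ℂ _ ⟨U, hU⟩) f A hcont
    (by
      change Continuous fun X : Matrix (Fin n) (Fin n) ℂ => U * X * star U
      fun_prop) hA
    (hA.map _)
  simpa using this.symm

theorem log_unitary_conj {U : Matrix (Fin n) (Fin n) ℂ} (hU : U ∈ unitaryGroup (Fin n) ℂ)
    (hA : IsSelfAdjoint A) : CFC.log (U * A * star U) = U * CFC.log A * star U :=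
  cfc_unitary_conj hU hA _

theorem PosDef.conj (hA : A.PosDef) {T : Matrix (Fin n) (Fin n) ℂ} (hT : IsUnit T) :
    (T * A * star T).PosDef := by
  exact (IsUnit.posDef_star_right_conjugate_iff hT).2 hA

theorem PosDef.cfcRpow_unitary_conj {U : Matrix (Fin n) (Fin n) ℂ}
    (hU : U ∈ unitaryGroup (Fin n) ℂ) (hA : A.PosDef) (r : ℝ) :
    (U * A * star U) ^ r = U * A ^ r * star U := by
  have hU' : IsUnit U := (Unitary.toUnits ⟨U, hU⟩).isUnit
  rw [CFC.rpow_eq_cfc_real hA.isStrictlyPositive.nonneg,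
    CFC.rpow_eq_cfc_real (hA.conj hU').isStrictlyPositive.nonneg,
    cfc_unitary_conj hU hA.isHermitian]

theorem PosDef.isUnit_cfcRpow (hA : A.PosDef) (r : ℝ) : IsUnit (A ^ r) := (hA.cfcRpow r).isUnit

theorem PosDef.conj_cfcRpow (hA : A.PosDef) (hB : B.PosDef) (r : ℝ) :
    (A ^ r * B * A ^ r).PosDef := by
  simpa only [star_cfcRpow] using hB.conj (hA.isUnit_cfcRpow r)

theorem PosDef.conj_conj_cfcRpow (hA : A.PosDef) (r : ℝ) :
    A ^ r * (A ^ (-r) * B * A ^ (-r)) * A ^ r = B := by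
  calc A ^ r * (A ^ (-r) * B * A ^ (-r)) * A ^ r
      = (A ^ r * A ^ (-r)) * B * (A ^ (-r) * A ^ r) := by simp only [mul_assoc]
    _ = B := by rw [hA.cfcRpow_mul_cfcRpow_neg, hA.cfcRpow_neg_mul_cfcRpow, one_mul, mul_one]

/-- Square roots of congruent positive definite matrices differ by a unitary. -/
theorem PosDef.exists_unitary_of_conj (hA : A.PosDef) {T : Matrix (Fin n) (Fin n) ℂ}
    (hT : IsUnit T) : ∃ U ∈ unitaryGroup (Fin n) ℂ,
      (T * A * star T) ^ (1 / 2 : ℝ) * U = T * A ^ (1 / 2 : ℝ) ∧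
      (T * A * star T) ^ (-(1 / 2) : ℝ) * T = U * A ^ (-(1 / 2) : ℝ) := by
  have hA' := hA.conj hT
  set A' := T * A * star T with hdef
  -- The witness is the unitary factor in the polar decomposition of `T * A ^ (1 / 2)`.
  refine ⟨A' ^ (-(1 / 2) : ℝ) * T * A ^ (1 / 2 : ℝ), ?_, ?_, ?_⟩
  · rw [mem_unitaryGroup_iff]
    calc A' ^ (-(1 / 2) : ℝ) * T * A ^ (1 / 2 : ℝ) * star (A' ^ (-(1 / 2) : ℝ) * T * A ^ (1 / 2 : ℝ))
        = A' ^ (-(1 / 2) : ℝ) * (T * (A ^ (1 / 2 : ℝ) * A ^ (1 / 2 : ℝ)) * star T)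
            * A' ^ (-(1 / 2) : ℝ) := by
          simp only [star_mul, star_cfcRpow, mul_assoc]
      _ = A' ^ (-(1 / 2) : ℝ) * A' ^ (1 : ℝ) * A' ^ (-(1 / 2) : ℝ) := by
          rw [hA.cfcRpow_half_mul_self, ← hdef, hA'.cfcRpow_one]
      _ = 1 := by
          rw [← hA'.cfcRpow_add, ← hA'.cfcRpow_add]
          norm_num [hA'.cfcRpow_zero]
  · rw [← mul_assoc, ← mul_assoc, hA'.cfcRpow_mul_cfcRpow_neg, one_mul]
  · rw [mul_assoc _ _ (A ^ (-(1 / 2) : ℝ)), hA.cfcRpow_mul_cfcRpow_neg, mul_one]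

end Matrix

/-! ### Continuity of N, pinching and diagonal norming functionals. -/

theorem Seminorm.map_sum_le {E ι : Type*} [AddCommGroup E] [Module ℂ E] (N : Seminorm ℂ E)
    (s : Finset ι) (f : ι → E) : N (∑ i ∈ s, f i) ≤ ∑ i ∈ s, N (f i) :=
  Finset.le_sum_of_subadditive N (map_zero N).le (map_add_le_add N) s f

theorem Seminorm.continuous_matrix {n : ℕ} (N : Seminorm ℂ (Matrix (Fin n) (Fin n) ℂ)) :
    Continuous N := by
  refine Seminorm.continuous_of_continuousAt_zero ?_
  have hle : ∀ X : Matrix (Fin n) (Fin n) ℂ,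
      N X ≤ ∑ i, ∑ j, ‖X i j‖ * N (Matrix.single i j 1) := by
    intro X
    conv_lhs => rw [Matrix.matrix_eq_sum_single X]
    refine (N.map_sum_le _ _).trans (Finset.sum_le_sum fun i _ => ?_)
    refine (N.map_sum_le _ _).trans (Finset.sum_le_sum fun j _ => ?_)
    rw [← map_smul_eq_mul, Matrix.smul_single, smul_eq_mul, mul_one]
  have hcont : Continuous fun X : Matrix (Fin n) (Fin n) ℂ =>
      ∑ i, ∑ j, ‖X i j‖ * N (Matrix.single i j 1) := by
    refine _root_.continuous_finsetSum _ fun i _ => _root_.continuous_finsetSum _ fun j _ => ?_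
    exact (continuous_id.matrix_elem i j).norm.mul continuous_const
  have h0 := hcont.tendsto 0
  simp only [Matrix.zero_apply, norm_zero, zero_mul, Finset.sum_const_zero] at h0
  unfold ContinuousAt
  rw [map_zero]
  exact squeeze_zero (fun X => apply_nonneg N X) hle h0

/-- Flipping the sign `ε i` permutes the sign vectors and negates every summand. -/
theorem sum_sign_mul_sign {n : ℕ} {i j : Fin n} (hij : i ≠ j) :
    ∑ ε : Fin n → ℤˣ, (((ε i : ℤ) : ℂ) * ((ε j : ℤ) : ℂ)) = 0 := by
  have h := Equiv.sum_comp (Equiv.mulLeft (Pi.mulSingle i (-1) : Fin n → ℤˣ))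
    (fun ε : Fin n → ℤˣ => (((ε i : ℤ) : ℂ) * ((ε j : ℤ) : ℂ)))
  simp only [Equiv.coe_mulLeft, Pi.mul_apply, Pi.mulSingle_eq_same,
    Pi.mulSingle_eq_of_ne hij.symm, one_mul, Units.val_neg, Int.cast_neg, neg_mul, Finset.sum_neg_distrib] at h
  exact self_eq_neg.1 h.symm

namespace IsUnitarilyInvariantNorm

variable {n : ℕ} {N : Seminorm ℂ (Matrix (Fin n) (Fin n) ℂ)}

theorem map_unitary_conj (hN : IsUnitarilyInvariantNorm N) {U : Matrix (Fin n) (Fin n) ℂ}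
    (hU : U ∈ Matrix.unitaryGroup (Fin n) ℂ) (X : Matrix (Fin n) (Fin n) ℂ) :
    N (U * X * star U) = N X :=
  hN.map_unitary_mul_mul U hU (star U) (Unitary.star_mem hU) X

/-- Averaging D X D over all diagonal sign matrices D kills the off-diagonal entries, and each D X D
has the same norm as X. -/
theorem map_diagonal_diag_le (hN : IsUnitarilyInvariantNorm N) (X : Matrix (Fin n) (Fin n) ℂ) :
    N (Matrix.diagonal X.diag) ≤ N X := by
  let D : (Fin n → ℤˣ) → Matrix (Fin n) (Fin n) ℂ :=
    fun ε => Matrix.diagonal fun i => ((ε i : ℤ) : ℂ)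
  have hD : ∀ ε, D ε ∈ Matrix.unitaryGroup (Fin n) ℂ := by
    intro ε
    rw [Matrix.mem_unitaryGroup_iff, Matrix.star_eq_conjTranspose, Matrix.diagonal_conjTranspose,
      Matrix.diagonal_mul_diagonal, ← Matrix.diagonal_one]
    congr 1
    funext i
    rcases Int.units_eq_one_or (ε i) with h | h <;> simp [h]
  have hsum : ∑ ε, D ε * X * D ε =
      (Fintype.card (Fin n → ℤˣ) : ℂ) • Matrix.diagonal X.diag := by
    ext i j
    rw [Matrix.sum_apply]
    simp only [D, Matrix.diagonal_mul, Matrix.mul_diagonal, Matrix.smul_apply, smul_eq_mul]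
    by_cases hij : i = j
    · subst hij
      rw [Matrix.diagonal_apply_eq, Matrix.diag_apply, ← nsmul_eq_mul, ← Finset.card_univ,
        ← Finset.sum_const]
      refine Finset.sum_congr rfl fun ε _ => ?_
      rcases Int.units_eq_one_or (ε i) with h | h <;> simp [h]
    · rw [Matrix.diagonal_apply_ne _ hij, mul_zero, ← mul_zero (X i j), ← sum_sign_mul_sign hij,
        Finset.mul_sum]
      exact Finset.sum_congr rfl fun ε _ => by ring
  have hcard : (0 : ℝ) < Fintype.card (Fin n → ℤˣ) := by exact_mod_cast Fintype.card_pos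
  have hle : N (∑ ε, D ε * X * D ε) ≤ Fintype.card (Fin n → ℤˣ) * N X := by
    refine (N.map_sum_le _ _).trans_eq ?_
    rw [Finset.sum_congr rfl fun ε _ => hN.map_unitary_mul_mul _ (hD ε) _ (hD ε) X,
      Finset.sum_const, Finset.card_univ, nsmul_eq_mul]
  rw [hsum, map_smul_eq_mul, Complex.norm_natCast] at hle
  exact le_of_mul_le_mul_left hle hcard

/-- A bound for the norms of the diagonal matrix units. -/
theorem exists_le_map_single : ∃ K : ℝ, 0 ≤ K ∧ ∀ i : Fin n, N (Matrix.single i i 1) ≤ K :=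
  ⟨∑ i, N (Matrix.single i i 1), Finset.sum_nonneg fun _ _ => apply_nonneg N _, fun i =>
    Finset.single_le_sum (f := fun i => N (Matrix.single i i 1)) (fun _ _ => apply_nonneg N _)
      (Finset.mem_univ i)⟩

/-- A functional norming a real diagonal matrix can be taken to be diagonal itself. -/
theorem exists_dual_diagonal (hN : IsUnitarilyInvariantNorm N) (h : Fin n → ℝ) :
    ∃ z : Fin n → ℝ, ∑ i, z i * h i = N (Matrix.diagonal fun i => (h i : ℂ)) ∧
      (∀ X : Matrix (Fin n) (Fin n) ℂ, X.IsHermitian → ∑ i, z i * (X i i).re ≤ N X) ∧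
      ∀ i, |z i| ≤ N (Matrix.single i i 1) := by
  let ι : (Fin n → ℝ) →ₗ[ℝ] Matrix (Fin n) (Fin n) ℂ :=
    { toFun := fun v => Matrix.diagonal fun i => (v i : ℂ)
      map_add' := fun v w => by ext i j; by_cases hij : i = j <;> simp [hij, Matrix.diagonal]
      map_smul' := fun c v => by ext i j; by_cases hij : i = j <;> simp [hij, Matrix.diagonal] }
  let p : Seminorm ℝ (Fin n → ℝ) := (N.restrictScalars ℝ).comp ι
  have hp : ∀ v, p v = N (Matrix.diagonal fun i => (v i : ℂ)) := fun v => rfl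
  -- Hahn–Banach on ℝⁿ, extending from the line spanned by `h`. Pinching later transfers the bound
  -- to all Hermitian matrices.
  obtain ⟨g, hg, hgp⟩ : ∃ g : Module.Dual ℝ (Fin n → ℝ), g h = p h ∧ ∀ x, |g x| ≤ p x := by
    let f := LinearPMap.mkSpanSingleton' (σ := RingHom.id ℝ) h (p h) (by
      intro c hc
      have := congrArg p hc
      rw [map_smul_eq_mul, map_zero] at this
      rcases mul_eq_zero.1 this with h1 | h1
      · simp [norm_eq_zero.1 h1]
      · simp [h1])
    obtain ⟨g, hg, hgp⟩ := Module.Dual.exists_extension_of_le_seminorm_real f.domain f.toFun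
      (p := p) (by
        rintro ⟨x, hx⟩
        obtain ⟨c, rfl⟩ := Submodule.mem_span_singleton.1 hx
        have : f ⟨c • h, hx⟩ = c • p h := LinearPMap.mkSpanSingleton'_apply _ _ _ _ _
        change f ⟨c • h, hx⟩ ≤ p (c • h)
        rw [this, map_smul_eq_mul, smul_eq_mul]
        exact mul_le_mul_of_nonneg_right (le_abs_self c) (apply_nonneg p h))
    refine ⟨g, ?_, hgp⟩
    have := hg ⟨h, Submodule.mem_span_singleton_self h⟩
    exact this.trans (LinearPMap.mkSpanSingleton'_apply_self _ _ _ _)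
  have hgsum : ∀ v : Fin n → ℝ, ∑ i, g (Pi.single i 1) * v i = g v := by
    intro v
    conv_rhs => rw [pi_eq_sum_univ' v, map_sum]
    refine Finset.sum_congr rfl fun i _ => ?_
    rw [map_smul, smul_eq_mul, mul_comm]
  refine ⟨fun i => g (Pi.single i 1), ?_, ?_, ?_⟩
  · rw [hgsum, hg, hp]
  · intro X hX
    rw [hgsum fun i => (X i i).re]
    refine (le_abs_self _).trans ((hgp _).trans ?_)
    rw [hp]
    have hdiag : (fun i => ((X i i).re : ℂ)) = X.diag := funext fun i => hX.coe_re_apply_self i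
    rw [hdiag]
    exact hN.map_diagonal_diag_le X
  · intro i
    refine (hgp _).trans_eq ?_
    rw [hp]
    congr 1
    ext j k
    by_cases hjk : j = k
    · subst hjk
      by_cases hij : i = j
      · subst hij; simp
      · simp [hij, Ne.symm hij]
    · rw [Matrix.diagonal_apply_ne _ hjk, Matrix.single_apply_of_ne]
      rintro ⟨rfl, rfl⟩
      exact hjk rfl

end IsUnitarilyInvariantNorm

/-! ### Diagonal entries in an orthonormal basis and Jensen's inequality. -/

namespace Matrix

variable {n : ℕ}

/-- The diagonal entries of a matrix in the orthonormal basis given by the columns of `U`. -/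
noncomputable def diagEntry (U : Matrix (Fin n) (Fin n) ℂ) (i : Fin n)
    (X : Matrix (Fin n) (Fin n) ℂ) : ℝ :=
  ((star U * X * U) i i).re

variable {U : Matrix (Fin n) (Fin n) ℂ} {i : Fin n} {X Y G : Matrix (Fin n) (Fin n) ℂ}

theorem diagEntry_add : diagEntry U i (X + Y) = diagEntry U i X + diagEntry U i Y := by
  simp [diagEntry, mul_add, add_mul]

theorem diagEntry_sub : diagEntry U i (X - Y) = diagEntry U i X - diagEntry U i Y := by
  simp [diagEntry, mul_sub, sub_mul]

theorem diagEntry_neg : diagEntry U i (-X) = -diagEntry U i X := by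
  simp [diagEntry]

theorem diagEntry_smul (c : ℝ) : diagEntry U i (c • X) = c * diagEntry U i X := by
  simp [diagEntry]

theorem diagEntry_one (hU : U ∈ unitaryGroup (Fin n) ℂ) : diagEntry U i 1 = 1 := by
  simp [diagEntry, mem_unitaryGroup_iff'.1 hU]

theorem diagEntry_mono (h : X ≤ Y) : diagEntry U i X ≤ diagEntry U i Y := by
  have h1 : (star U * (Y - X) * U).PosSemidef := (le_iff.1 h).conjTranspose_mul_mul_same U
  have h2 : 0 ≤ diagEntry U i (Y - X) := (Complex.le_def.1 h1.diag_nonneg).1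
  rw [diagEntry_sub] at h2
  linarith

theorem PosDef.diagEntry_pos (hU : U ∈ unitaryGroup (Fin n) ℂ) (hG : G.PosDef) :
    0 < diagEntry U i G := by
  have hU' : IsUnit U := (Unitary.toUnits ⟨U, hU⟩).isUnit
  have h1 : (star U * G * U).PosDef := (IsUnit.posDef_star_left_conjugate_iff hU').2 hG
  exact (Complex.lt_def.1 h1.diag_pos).1

theorem diagEntry_le_norm (hU : U ∈ unitaryGroup (Fin n) ℂ) (hX : IsSelfAdjoint X) :
    diagEntry U i X ≤ ‖X‖ := by
  have h : X ≤ ‖X‖ • (1 : Matrix (Fin n) (Fin n) ℂ) := by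
    rw [← Algebra.algebraMap_eq_smul_one]
    exact hX.le_algebraMap_norm_self
  simpa [diagEntry_smul, diagEntry_one hU] using diagEntry_mono (U := U) (i := i) h

/-- Jensen's inequality: log lies below its tangent at `a = diagEntry U i G`. The functional
calculus makes this an operator inequality, and its diagonal entry is the claim. -/
theorem PosDef.diagEntry_log_le (hU : U ∈ unitaryGroup (Fin n) ℂ) (hG : G.PosDef) :
    diagEntry U i (CFC.log G) ≤ Real.log (diagEntry U i G) := by
  set a := diagEntry U i G with ha
  have hapos : 0 < a := hG.diagEntry_pos hU
  have hG' : IsSelfAdjoint G := hG.isHermitian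
  have hlog := hG.continuousOn_log_spectrum
  have h1 : CFC.log G ≤ (Real.log a - 1) • (1 : Matrix (Fin n) (Fin n) ℂ) + a⁻¹ • G := by
    have h2 : cfc (fun x : ℝ => (Real.log a - 1) + a⁻¹ * x) G =
        (Real.log a - 1) • (1 : Matrix (Fin n) (Fin n) ℂ) + a⁻¹ • G := by
      rw [cfc_const_add _ _ G, cfc_const_mul_id _ G, Algebra.algebraMap_eq_smul_one]
    rw [← h2, CFC.log]
    refine cfc_mono (fun x hx => ?_) hlog
    have hx0 := hG.pos_of_mem_spectrum hx
    have := Real.log_le_sub_one_of_pos (div_pos hx0 hapos)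
    rw [Real.log_div hx0.ne' hapos.ne', div_eq_inv_mul] at this
    linarith
  have h3 := diagEntry_mono (U := U) (i := i) h1
  rw [diagEntry_add, diagEntry_smul, diagEntry_smul, diagEntry_one hU, ← ha,
    inv_mul_cancel₀ hapos.ne'] at h3
  linarith

/-- Spectral resolution of a positive definite matrix and of the functions of it. -/
theorem PosDef.exists_spectral {C : Matrix (Fin n) (Fin n) ℂ} (hC : C.PosDef) :
    ∃ U ∈ unitaryGroup (Fin n) ℂ, ∃ c : Fin n → ℝ, (∀ i, 0 < c i) ∧
      ∀ f : ℝ → ℝ, cfc f C = U * diagonal (fun i => (f (c i) : ℂ)) * star U :=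
  ⟨hC.isHermitian.eigenvectorUnitary, hC.isHermitian.eigenvectorUnitary.2,
    hC.isHermitian.eigenvalues, hC.eigenvalues_pos, fun f => hC.isHermitian.cfc_eq f⟩

theorem diagEntry_conj {d : Fin n → ℝ} {S : Matrix (Fin n) (Fin n) ℂ}
    (hU : U ∈ unitaryGroup (Fin n) ℂ) (hS : S = U * diagonal (fun i => (d i : ℂ)) * star U) :
    diagEntry U i (S * X * S) = d i * d i * diagEntry U i X := by
  have hUU : star U * U = 1 := mem_unitaryGroup_iff'.1 hU
  have h : star U * (S * X * S) * U =
      diagonal (fun i => (d i : ℂ)) * (star U * X * U) * diagonal (fun i => (d i : ℂ)) := by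
    calc star U * (S * X * S) * U
        = (star U * U) * diagonal (fun i => (d i : ℂ)) * (star U * X * U) *
            diagonal (fun i => (d i : ℂ)) * (star U * U) := by rw [hS]; simp only [mul_assoc]
      _ = _ := by rw [hUU, one_mul, mul_one]
  rw [diagEntry, h, mul_diagonal, diagonal_mul, diagEntry, mul_right_comm, ← Complex.ofReal_mul,
    Complex.re_ofReal_mul]

end Matrix

/-! ### The first-order comparison of two logarithms. -/

namespace IsUnitarilyInvariantNorm

open Matrix

variable {n : ℕ} {N : Seminorm ℂ (Matrix (Fin n) (Fin n) ℂ)}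

/-- With M = C^{-1/2} G C^{-1/2}, the last term is the norm of M⁻¹ + M - 2 = M⁻¹(1 - M)², of second
order when G is near C. The constant depends only on N and n, as is needed for a limit along a
curve. -/
theorem map_log_le (hN : IsUnitarilyInvariantNorm N) : ∃ K : ℝ, 0 ≤ K ∧
    ∀ C G : Matrix (Fin n) (Fin n) ℂ, C.PosDef → G.PosDef →
      N (CFC.log C) ≤ N (CFC.log G) + N (1 - C ^ (-(1 / 2) : ℝ) * G * C ^ (-(1 / 2) : ℝ)) +
        K * ‖C ^ (1 / 2 : ℝ) * G ^ (-1 : ℝ) * C ^ (1 / 2 : ℝ) +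
          C ^ (-(1 / 2) : ℝ) * G * C ^ (-(1 / 2) : ℝ) - 1 - 1‖ := by
  obtain ⟨K, hK0, hK⟩ := exists_le_map_single (N := N)
  refine ⟨n * K, by positivity, fun C G hC hG => ?_⟩
  obtain ⟨U, hU, c, hc, hcfc⟩ := hC.exists_spectral
  obtain ⟨z, hz, hzN, hzK⟩ := hN.exists_dual_diagonal fun i => Real.log (c i)
  have hlogC : N (CFC.log C) = ∑ i, z i * Real.log (c i) := by
    rw [CFC.log, hcfc, hN.map_unitary_conj hU, hz]
  have hzN' : ∀ X : Matrix (Fin n) (Fin n) ℂ, IsSelfAdjoint X →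
      ∑ i, z i * diagEntry U i X ≤ N X := by
    intro X hX
    refine (hzN (star U * X * U) ?_).trans_eq ?_
    · exact isHermitian_conjTranspose_mul_mul U hX
    · exact hN.map_unitary_mul_mul _ (Unitary.star_mem hU) _ hU X
  have hG1 := hG.cfcRpow (-1)
  have hM := hC.conj_cfcRpow hG (-(1 / 2))
  have hM1 := hC.conj_cfcRpow hG1 (1 / 2)
  have hMi : ∀ i, diagEntry U i (C ^ (-(1 / 2) : ℝ) * G * C ^ (-(1 / 2) : ℝ)) =
      (c i)⁻¹ * diagEntry U i G := by
    intro i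
    rw [diagEntry_conj hU (by rw [CFC.rpow_eq_cfc_real hC.isStrictlyPositive.nonneg, hcfc]),
      ← Real.rpow_add (hc i), ← Real.rpow_neg_one]
    norm_num
  have hM1i : ∀ i, diagEntry U i (C ^ (1 / 2 : ℝ) * G ^ (-1 : ℝ) * C ^ (1 / 2 : ℝ)) =
      c i * diagEntry U i (G ^ (-1 : ℝ)) := by
    intro i
    rw [diagEntry_conj hU (by rw [CFC.rpow_eq_cfc_real hC.isStrictlyPositive.nonneg, hcfc]),
      ← Real.rpow_add (hc i), add_halves, Real.rpow_one]
  set M := C ^ (-(1 / 2) : ℝ) * G * C ^ (-(1 / 2) : ℝ) with hMdef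
  set M1 := C ^ (1 / 2 : ℝ) * G ^ (-1 : ℝ) * C ^ (1 / 2 : ℝ) with hM1def
  have hMsa : IsSelfAdjoint M := hM.isHermitian
  have hM1sa : IsSelfAdjoint M1 := hM1.isHermitian
  have hE : IsSelfAdjoint (M1 + M - 1 - 1) := ((hM1sa.add hMsa).sub (.one _)).sub (.one _)
  have hterm : ∀ i, z i * (Real.log (c i) - diagEntry U i (CFC.log G)) ≤
      z i * diagEntry U i (1 - M) + K * ‖M1 + M - 1 - 1‖ := by
    intro i
    have hpos1 : 0 < diagEntry U i (G ^ (-1 : ℝ)) := hG1.diagEntry_pos hU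
    have hpos : 0 < diagEntry U i G := hG.diagEntry_pos hU
    have hle := diagEntry_le_norm (i := i) hU hE
    have hnn : 0 ≤ ‖M1 + M - 1 - 1‖ := norm_nonneg _
    rw [diagEntry_sub, diagEntry_sub, diagEntry_add, diagEntry_one hU] at hle
    rw [diagEntry_sub, diagEntry_one hU]
    -- The sign of `z i` decides which bound is needed. A nonnegative weight needs an upper bound,
    -- from Jensen for G⁻¹; this produces M⁻¹ - 1, which is traded for 1 - M at the cost of the
    -- error term. A nonpositive weight needs a lower bound, and Jensen for G gives 1 - M directly.
    rcases le_total 0 (z i) with h0 | h0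
    · have h1 := hG1.diagEntry_log_le (i := i) hU
      rw [hG.log_cfcRpow_neg_one, diagEntry_neg] at h1
      have h2 := Real.log_le_sub_one_of_pos (mul_pos (hc i) hpos1)
      rw [Real.log_mul (hc i).ne' hpos1.ne', ← hM1i] at h2
      have h3 : z i * (Real.log (c i) - diagEntry U i (CFC.log G)) ≤
          z i * (1 - diagEntry U i M + ‖M1 + M - 1 - 1‖) :=
        mul_le_mul_of_nonneg_left (by linarith) h0
      have h4 : z i * ‖M1 + M - 1 - 1‖ ≤ K * ‖M1 + M - 1 - 1‖ :=
        mul_le_mul_of_nonneg_right ((le_abs_self _).trans ((hzK i).trans (hK i))) hnn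
      linarith
    · have h1 := hG.diagEntry_log_le (i := i) hU
      have h2 := Real.log_le_sub_one_of_pos (mul_pos (inv_pos.2 (hc i)) hpos)
      rw [Real.log_mul (inv_pos.2 (hc i)).ne' hpos.ne', ← hMi, Real.log_inv] at h2
      have h3 : z i * (Real.log (c i) - diagEntry U i (CFC.log G)) ≤
          z i * (1 - diagEntry U i M) :=
        mul_le_mul_of_nonpos_left (by linarith) h0
      have h4 : 0 ≤ K * ‖M1 + M - 1 - 1‖ := mul_nonneg hK0 hnn
      linarith
  have hsum := Finset.sum_le_sum fun i (_ : i ∈ Finset.univ) => hterm i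
  simp only [mul_sub, Finset.sum_sub_distrib, Finset.sum_add_distrib, Finset.sum_const,
    Finset.card_univ, Fintype.card_fin, nsmul_eq_mul] at hsum
  have h1 := hzN' (CFC.log G) .log
  have h2 := hzN' (1 - M) ((IsSelfAdjoint.one _).sub hMsa)
  rw [hlogC]
  linarith

end IsUnitarilyInvariantNorm

/-! ### Growth of N(log α) along a curve. -/

open Filter Topology MeasureTheory

namespace Matrix

variable {n : ℕ}

theorem continuousOn_cfcRpow (r : ℝ) :
    ContinuousOn (fun A : Matrix (Fin n) (Fin n) ℂ => A ^ r) {A | A.PosDef} :=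
  (CFC.continuousOn_rpow r).mono fun _ hA => hA.isStrictlyPositive

theorem continuousOn_log :
    ContinuousOn (CFC.log : Matrix (Fin n) (Fin n) ℂ → _) {A | A.PosDef} :=
  CFC.continuousOn_log.mono fun _ hA => ⟨hA.isHermitian, hA.isUnit⟩

end Matrix

namespace IsUnitarilyInvariantNorm

open Matrix

variable {n : ℕ} {N : Seminorm ℂ (Matrix (Fin n) (Fin n) ℂ)}
  {α : ℝ → Matrix (Fin n) (Fin n) ℂ} {a b : ℝ}

/-- The comparison of logarithms is applied with C = α z, the later point, and G = α x. After
division by z - x the main term tends to the speed at x and the error term vanishes. -/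
theorem frequently_slope_lt (hN : IsUnitarilyInvariantNorm N)
    (hpos : ∀ t ∈ Icc a b, (α t).PosDef) {x : ℝ} (hx : x ∈ Ico a b)
    {α' : Matrix (Fin n) (Fin n) ℂ} (hα : HasDerivWithinAt α α' (Icc a b) x) {r : ℝ}
    (hr : N (α x ^ (-(1 / 2) : ℝ) * α' * α x ^ (-(1 / 2) : ℝ)) < r) :
    ∃ᶠ z in 𝓝[>] x, slope (fun t => N (CFC.log (α t))) x z < r := by
  obtain ⟨K, hK0, hK⟩ := hN.map_log_le
  have hxI : x ∈ Icc a b := ⟨hx.1, hx.2.le⟩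
  have hmem : ∀ᶠ z in 𝓝[>] x, z ∈ Icc a b := by
    filter_upwards [Ioo_mem_nhdsGT hx.2] with z hz
    exact ⟨hx.1.trans hz.1.le, hz.2.le⟩
  have hle : 𝓝[>] x ≤ 𝓝[Icc a b \ {x}] x := by
    refine le_inf inf_le_left (le_principal_iff.2 ?_)
    filter_upwards [hmem, self_mem_nhdsWithin] with z hz hz'
    exact ⟨hz, ne_of_gt hz'⟩
  have hslope : Tendsto (slope α x) (𝓝[>] x) (𝓝 α') :=
    (hasDerivWithinAt_iff_tendsto_slope.1 hα).mono_left hle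
  have hcont : Tendsto α (𝓝[>] x) (𝓝 (α x)) :=
    hα.continuousWithinAt.tendsto.mono_left (hle.trans (nhdsWithin_mono _ sdiff_subset))
  have hpow : ∀ p : ℝ, Tendsto (fun z => α z ^ p) (𝓝[>] x) (𝓝 (α x ^ p)) := by
    intro p
    refine (continuousOn_cfcRpow p (α x) (hpos x hxI)).tendsto.comp
      (tendsto_nhdsWithin_iff.2 ⟨hcont, ?_⟩)
    filter_upwards [hmem] with z hz using hpos z hz
  let S : ℝ → Matrix (Fin n) (Fin n) ℂ :=
    fun z => α z ^ (-(1 / 2) : ℝ) * slope α x z * α z ^ (-(1 / 2) : ℝ)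
  let R : ℝ → Matrix (Fin n) (Fin n) ℂ :=
    fun z => α z ^ (1 / 2 : ℝ) * α x ^ (-1 : ℝ) * α z ^ (1 / 2 : ℝ)
  have hS : Tendsto S (𝓝[>] x) (𝓝 (α x ^ (-(1 / 2) : ℝ) * α' * α x ^ (-(1 / 2) : ℝ))) :=
    ((hpow _).mul hslope).mul (hpow _)
  have hR : Tendsto R (𝓝[>] x) (𝓝 (α x ^ (1 / 2 : ℝ) * α x ^ (-1 : ℝ) * α x ^ (1 / 2 : ℝ))) :=
    ((hpow _).mul tendsto_const_nhds).mul (hpow _)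
  have hsub : Tendsto (fun z => z - x) (𝓝[>] x) (𝓝 0) := by
    have : Tendsto (fun z : ℝ => z - x) (𝓝 x) (𝓝 (x - x)) :=
      (continuous_id.sub continuous_const).tendsto x
    rw [sub_self] at this
    exact this.mono_left inf_le_left
  have hbound : Tendsto (fun z => N (S z) + K * ‖(z - x) • (R z * S z * S z)‖) (𝓝[>] x)
      (𝓝 (N (α x ^ (-(1 / 2) : ℝ) * α' * α x ^ (-(1 / 2) : ℝ)))) := by
    have h1 := (N.continuous_matrix.tendsto _).comp hS
    have h2 := ((hsub.smul ((hR.mul hS).mul hS)).norm).const_mul K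
    simpa using h1.add h2
  refine Eventually.frequently ?_
  filter_upwards [hmem, self_mem_nhdsWithin, hbound.eventually (gt_mem_nhds hr)] with z hz hxz hlt
  refine lt_of_le_of_lt ?_ hlt
  have hzx : 0 < z - x := sub_pos.2 hxz
  have hC := hpos z hz
  have hG := hpos x hxI
  have h1M : 1 - α z ^ (-(1 / 2) : ℝ) * α x * α z ^ (-(1 / 2) : ℝ) = (z - x) • S z := by
    have h2 : (z - x) • S z = α z ^ (-(1 / 2) : ℝ) * (α z - α x) * α z ^ (-(1 / 2) : ℝ) := by
      simp only [S, slope_def_module]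
      rw [mul_smul_comm, smul_mul_assoc, smul_smul, mul_inv_cancel₀ hzx.ne', one_smul]
    rw [h2, mul_sub, sub_mul, hC.cfcRpow_neg_half_conj_self]
  have hRM : R z * (α z ^ (-(1 / 2) : ℝ) * α x * α z ^ (-(1 / 2) : ℝ)) = 1 := by
    calc R z * (α z ^ (-(1 / 2) : ℝ) * α x * α z ^ (-(1 / 2) : ℝ))
        = α z ^ (1 / 2 : ℝ) * (α x ^ (-1 : ℝ) * ((α z ^ (1 / 2 : ℝ) * α z ^ (-(1 / 2) : ℝ)) * α x)) *
            α z ^ (-(1 / 2) : ℝ) := by simp only [R, mul_assoc]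
      _ = 1 := by
          rw [hC.cfcRpow_mul_cfcRpow_neg, one_mul]
          nth_rewrite 2 [← hG.cfcRpow_one]
          rw [hG.cfcRpow_neg_mul_cfcRpow, mul_one, hC.cfcRpow_mul_cfcRpow_neg]
  have hE : R z + α z ^ (-(1 / 2) : ℝ) * α x * α z ^ (-(1 / 2) : ℝ) - 1 - 1 =
      (z - x) • ((z - x) • (R z * S z * S z)) := by
    -- `R z` is the inverse of M, so this is M⁻¹ + M - 2 = M⁻¹(1 - M)², quadratic in z - x.
    have h4 : R z + α z ^ (-(1 / 2) : ℝ) * α x * α z ^ (-(1 / 2) : ℝ) - 1 - 1 =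
        R z * (1 - α z ^ (-(1 / 2) : ℝ) * α x * α z ^ (-(1 / 2) : ℝ)) *
          (1 - α z ^ (-(1 / 2) : ℝ) * α x * α z ^ (-(1 / 2) : ℝ)) := by
      rw [mul_sub (R z), hRM, mul_one, sub_mul, one_mul, mul_sub, hRM, mul_one]
      abel
    rw [h4, h1M, mul_smul_comm, mul_smul_comm, smul_mul_assoc]
  have hmain := hK (α z) (α x) hC hG
  rw [hE, h1M, ← Complex.coe_smul, map_smul_eq_mul, Complex.norm_real, norm_smul,
    Real.norm_of_nonneg hzx.le] at hmain
  rw [slope_def_field, div_le_iff₀ hzx]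
  linarith

/-- Along a smooth curve the norm of the logarithm grows at most by the length of the curve. -/
theorem map_log_sub_le_integral (hN : IsUnitarilyInvariantNorm N) (hab : a ≤ b)
    (hpos : ∀ t ∈ Icc a b, (α t).PosDef) (hα : ContDiffOn ℝ 1 α (Icc a b)) :
    IntervalIntegrable (fun t => N (α t ^ (-(1 / 2) : ℝ) * deriv α t * α t ^ (-(1 / 2) : ℝ)))
      volume a b ∧
    N (CFC.log (α b)) - N (CFC.log (α a)) ≤
      ∫ t in a..b, N (α t ^ (-(1 / 2) : ℝ) * deriv α t * α t ^ (-(1 / 2) : ℝ)) := by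
  rcases hab.eq_or_lt with rfl | hab'
  · simp
  have huniq : UniqueDiffOn ℝ (Icc a b) := uniqueDiffOn_Icc hab'
  have hpow : ∀ p : ℝ, ContinuousOn (fun t => α t ^ p) (Icc a b) := fun p =>
    (continuousOn_cfcRpow p).comp hα.continuousOn hpos
  let g : ℝ → ℝ := fun t =>
    N (α t ^ (-(1 / 2) : ℝ) * derivWithin α (Icc a b) t * α t ^ (-(1 / 2) : ℝ))
  have hg : ContinuousOn g (Icc a b) :=
    N.continuous_matrix.comp_continuousOn
      (((hpow _).mul (hα.continuousOn_derivWithin huniq le_rfl)).mul (hpow _))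
  -- `deriv α` may be wrong at the end points. The one-sided speed extends to a continuous function
  -- on ℝ that agrees with the integrand inside the interval, so its primitive is differentiable
  -- everywhere.
  let g' : ℝ → ℝ := IccExtend hab ((Icc a b).domRestrict g)
  have hg' : Continuous g' := (continuousOn_iff_continuous_domRestrict.1 hg).Icc_extend'
  have hgg' : ∀ t ∈ Icc a b, g' t = g t := fun t ht => IccExtend_of_mem hab _ ht
  have hEq : ∀ t ∈ Ioo a b,
      N (α t ^ (-(1 / 2) : ℝ) * deriv α t * α t ^ (-(1 / 2) : ℝ)) = g' t := by
    intro t ht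
    rw [hgg' t (Ioo_subset_Icc_self ht)]
    simp only [g]
    rw [derivWithin_of_mem_nhds (Icc_mem_nhds ht.1 ht.2)]
  have hae : ∀ᵐ t ∂volume, t ∈ uIoc a b →
      g' t = N (α t ^ (-(1 / 2) : ℝ) * deriv α t * α t ^ (-(1 / 2) : ℝ)) := by
    have hb : ∀ᵐ t : ℝ ∂volume, t ≠ b := by simp [ae_iff, measure_singleton]
    filter_upwards [hb] with t htb ht
    rw [uIoc_of_le hab] at ht
    exact (hEq t ⟨ht.1, lt_of_le_of_ne ht.2 htb⟩).symm
  refine ⟨(hg'.intervalIntegrable a b).congr_ae ?_, ?_⟩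
  · rwa [Filter.EventuallyEq, ae_restrict_iff' measurableSet_uIoc]
  rw [← intervalIntegral.integral_congr_ae hae]
  have hf : ContinuousOn (fun t => N (CFC.log (α t))) (Icc a b) :=
    N.continuous_matrix.comp_continuousOn (continuousOn_log.comp hα.continuousOn hpos)
  have hB : ∀ x, HasDerivAt (fun t => N (CFC.log (α a)) + ∫ u in a..t, g' u) (g' x) x := fun x =>
    (hg'.integral_hasStrictDerivAt a x).hasDerivAt.const_add _
  have hfin := image_le_of_liminf_slope_right_le_deriv_boundary hf
    (B := fun t => N (CFC.log (α a)) + ∫ u in a..t, g' u) (B' := g') (by simp)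
    (fun x _ => (hB x).continuousAt.continuousWithinAt)
    (fun x _ => (hB x).hasDerivWithinAt) (by
      intro x hx r hr
      have hxI : x ∈ Icc a b := ⟨hx.1, hx.2.le⟩
      rw [hgg' x hxI] at hr
      exact hN.frequently_slope_lt hpos hx
        ((hα.differentiableOn one_ne_zero) x hxI).hasDerivWithinAt hr)
  have := hfin (right_mem_Icc.2 hab)
  linarith

end IsUnitarilyInvariantNorm

namespace IsPosCurve

open Matrix

variable {n : ℕ} {N : Seminorm ℂ (Matrix (Fin n) (Fin n) ℂ)} {A B : Matrix (Fin n) (Fin n) ℂ}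
  {α : ℝ → Matrix (Fin n) (Fin n) ℂ}

theorem map_log_le (hN : IsUnitarilyInvariantNorm N) (h : IsPosCurve A B α) :
    N (CFC.log B) ≤ N (CFC.log A) + finslerLength N α := by
  obtain ⟨k, τ, hτ, hτ0, hτk, hsm⟩ := h.piecewise_smooth
  have hpiece : ∀ i < k, _ := fun i hi =>
    hN.map_log_sub_le_integral (α := α) (hτ i.le_succ)
      (fun t ht => h.posDef t ⟨(hτ0 ▸ hτ (Nat.zero_le i)).trans ht.1,
        ht.2.trans (hτk ▸ hτ (Nat.succ_le_of_lt hi))⟩)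
      ((hsm i hi).of_le (by exact_mod_cast le_top))
  have hsum := intervalIntegral.sum_integral_adjacent_intervals (μ := volume)
    (f := fun t => N (α t ^ (-(1 / 2) : ℝ) * deriv α t * α t ^ (-(1 / 2) : ℝ))) (a := τ) (n := k)
    fun i hi => (hpiece i hi).1
  have htel := Finset.sum_range_sub (fun i => N (CFC.log (α (τ i)))) k
  have hle := Finset.sum_le_sum fun i (hi : i ∈ Finset.range k) =>
    (hpiece i (Finset.mem_range.1 hi)).2
  rw [hsum, hτ0, hτk] at hle
  rw [htel, hτ0, hτk, h.source, h.target] at hle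
  rw [finslerLength]
  linarith

end IsPosCurve

/-! ### Congruence invariance and the length of geodesics. -/

namespace Matrix

variable {n : ℕ} {A B : Matrix (Fin n) (Fin n) ℂ}

theorem PosDef.cfcRpow_cfcRpow (hA : A.PosDef) (r s : ℝ) : (A ^ r) ^ s = A ^ (r * s) := by
  rcases eq_or_ne r 0 with rfl | hr
  · rw [hA.cfcRpow_zero, CFC.one_rpow, zero_mul, hA.cfcRpow_zero]
  · exact CFC.rpow_rpow A r s hr hA.isStrictlyPositive

theorem PosDef.hasDerivAt_cfcRpow (hA : A.PosDef) (t : ℝ) :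
    HasDerivAt (fun s : ℝ => A ^ s) (A ^ t * CFC.log A) t := by
  simp only [hA.exp_smul_log]
  exact hasDerivAt_exp_smul_const (CFC.log A) t

theorem PosDef.contDiff_cfcRpow (hA : A.PosDef) : ContDiff ℝ ∞ fun s : ℝ => A ^ s := by
  simp only [hA.exp_smul_log]
  have hexp : ContDiff ℝ ∞ (NormedSpace.exp : Matrix (Fin n) (Fin n) ℂ → _) :=
    contDiff_iff_contDiffAt.2 fun X => (NormedSpace.exp_analytic (𝕂 := ℝ) X).contDiffAt
  exact hexp.comp (contDiff_id.smul contDiff_const)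

theorem PosDef.commute_cfcRpow_log (hA : A.PosDef) (t : ℝ) : Commute (A ^ t) (CFC.log A) := by
  rw [hA.exp_smul_log]
  exact ((Commute.refl (CFC.log A)).smul_left t).exp_left

end Matrix

namespace IsUnitarilyInvariantNorm

open Matrix

variable {n : ℕ} {N : Seminorm ℂ (Matrix (Fin n) (Fin n) ℂ)} {A B : Matrix (Fin n) (Fin n) ℂ}
  {T : Matrix (Fin n) (Fin n) ℂ}

/-- The two normalised tangent vectors are conjugate by the unitary of `exists_unitary_of_conj`. -/
theorem map_conj_cfcRpow (hN : IsUnitarilyInvariantNorm N) (hA : A.PosDef) (hT : IsUnit T)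
    (X : Matrix (Fin n) (Fin n) ℂ) :
    N ((T * A * star T) ^ (-(1 / 2) : ℝ) * (T * X * star T) * (T * A * star T) ^ (-(1 / 2) : ℝ)) =
      N (A ^ (-(1 / 2) : ℝ) * X * A ^ (-(1 / 2) : ℝ)) := by
  obtain ⟨U, hU, -, h⟩ := hA.exists_unitary_of_conj hT
  rw [← hN.map_unitary_conj hU (A ^ _ * X * A ^ _)]
  congr 1
  have h' := congrArg star h
  simp only [star_mul, star_cfcRpow] at h'
  calc _ = ((T * A * star T) ^ (-(1 / 2) : ℝ) * T) * X *
        (star T * (T * A * star T) ^ (-(1 / 2) : ℝ)) := by simp only [mul_assoc]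
    _ = _ := by rw [h, h']; simp only [mul_assoc]

theorem map_log_conj_cfcRpow (hN : IsUnitarilyInvariantNorm N) (hA : A.PosDef) (hB : B.PosDef)
    (hT : IsUnit T) :
    N (CFC.log ((T * A * star T) ^ (-(1 / 2) : ℝ) * (T * B * star T) *
      (T * A * star T) ^ (-(1 / 2) : ℝ))) =
      N (CFC.log (A ^ (-(1 / 2) : ℝ) * B * A ^ (-(1 / 2) : ℝ))) := by
  obtain ⟨U, hU, -, h⟩ := hA.exists_unitary_of_conj hT
  have h' := congrArg star h
  simp only [star_mul, star_cfcRpow] at h'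
  rw [← hN.map_unitary_conj hU (CFC.log (A ^ _ * B * A ^ _)), ← log_unitary_conj hU (hA.conj_cfcRpow hB _).isHermitian]
  congr 2
  calc _ = ((T * A * star T) ^ (-(1 / 2) : ℝ) * T) * B *
        (star T * (T * A * star T) ^ (-(1 / 2) : ℝ)) := by simp only [mul_assoc]
    _ = _ := by rw [h, h']; simp only [mul_assoc]

end IsUnitarilyInvariantNorm

/-- Invertibility of T makes both curves differentiable at the same points; elsewhere both
derivatives take the default value 0. -/
theorem Matrix.deriv_conj {n : ℕ} {T : Matrix (Fin n) (Fin n) ℂ} (hT : IsUnit T)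
    (α : ℝ → Matrix (Fin n) (Fin n) ℂ) (t : ℝ) :
    deriv (fun s => T * α s * star T) t = T * deriv α t * star T := by
  by_cases h : DifferentiableAt ℝ α t
  · exact ((h.hasDerivAt.const_mul T).mul_const (star T)).deriv
  · have h' : ¬ DifferentiableAt ℝ (fun s => T * α s * star T) t := by
      intro hd
      obtain ⟨u, rfl⟩ := hT
      apply h
      have := (hd.const_mul (↑u⁻¹ : Matrix (Fin n) (Fin n) ℂ)).mul_const
        (star (↑u⁻¹ : Matrix (Fin n) (Fin n) ℂ))
      refine this.congr_of_eventuallyEq (Eventually.of_forall fun s => ?_)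
      have h1 : (star (u : Matrix (Fin n) (Fin n) ℂ)) * star (↑u⁻¹ : Matrix (Fin n) (Fin n) ℂ) = 1 := by
        rw [← star_mul, Units.inv_mul, star_one]
      simp only
      rw [mul_assoc, mul_assoc, h1, mul_one, Units.inv_mul_cancel_left]
    rw [deriv_zero_of_not_differentiableAt h, deriv_zero_of_not_differentiableAt h', mul_zero,
      zero_mul]

namespace IsPosCurve

open Matrix

variable {n : ℕ} {N : Seminorm ℂ (Matrix (Fin n) (Fin n) ℂ)} {A B : Matrix (Fin n) (Fin n) ℂ}
  {T : Matrix (Fin n) (Fin n) ℂ} {α : ℝ → Matrix (Fin n) (Fin n) ℂ}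

theorem conj (h : IsPosCurve A B α) (hT : IsUnit T) :
    IsPosCurve (T * A * star T) (T * B * star T) fun t => T * α t * star T where
  source := by rw [h.source]
  target := by rw [h.target]
  posDef t ht := (h.posDef t ht).conj hT
  continuousOn := (continuousOn_const.mul h.continuousOn).mul continuousOn_const
  piecewise_smooth := by
    obtain ⟨k, τ, hτ, hτ0, hτk, hsm⟩ := h.piecewise_smooth
    exact ⟨k, τ, hτ, hτ0, hτk, fun i hi => (contDiffOn_const.mul (hsm i hi)).mul contDiffOn_const⟩

theorem finslerLength_conj (hN : IsUnitarilyInvariantNorm N) (h : IsPosCurve A B α)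
    (hT : IsUnit T) : finslerLength N (fun t => T * α t * star T) = finslerLength N α := by
  refine intervalIntegral.integral_congr fun t ht => ?_
  rw [uIcc_of_le zero_le_one] at ht
  simp only [deriv_conj hT]
  exact hN.map_conj_cfcRpow (h.posDef t ht) hT _

end IsPosCurve

namespace Matrix

variable {n : ℕ} {N : Seminorm ℂ (Matrix (Fin n) (Fin n) ℂ)} {A B M : Matrix (Fin n) (Fin n) ℂ}

theorem PosDef.isPosCurve_cfcRpow (hM : M.PosDef) : IsPosCurve 1 M fun s => M ^ s where
  source := hM.cfcRpow_zero
  target := hM.cfcRpow_one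
  posDef t _ := hM.cfcRpow t
  continuousOn := hM.contDiff_cfcRpow.continuous.continuousOn
  piecewise_smooth := ⟨1, fun i => i, Nat.mono_cast, Nat.cast_zero, Nat.cast_one,
    fun _ _ => hM.contDiff_cfcRpow.contDiffOn⟩

/-- The speed is constant: log M commutes with the powers of M, which cancel. -/
theorem PosDef.finslerLength_cfcRpow (hM : M.PosDef) :
    finslerLength N (fun s => M ^ s) = N (CFC.log M) := by
  have h : ∀ t : ℝ, N ((M ^ t) ^ (-(1 / 2) : ℝ) * deriv (fun s : ℝ => M ^ s) t *
      (M ^ t) ^ (-(1 / 2) : ℝ)) = N (CFC.log M) := by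
    intro t
    rw [(hM.hasDerivAt_cfcRpow t).deriv, hM.cfcRpow_cfcRpow, mul_assoc, mul_assoc,
      ← (hM.commute_cfcRpow_log _).eq, ← mul_assoc, ← mul_assoc, ← hM.cfcRpow_add,
      ← hM.cfcRpow_add]
    ring_nf
    rw [hM.cfcRpow_zero, one_mul]
  rw [finslerLength]
  simp only [h]
  simp

theorem posGeodesic_eq_conj (A B : Matrix (Fin n) (Fin n) ℂ) :
    posGeodesic A B = fun s => A ^ (1 / 2 : ℝ) *
      (A ^ (-(1 / 2) : ℝ) * B * A ^ (-(1 / 2) : ℝ)) ^ s * star (A ^ (1 / 2 : ℝ)) := by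
  funext s
  rw [star_cfcRpow, posGeodesic]

theorem PosDef.isPosCurve_posGeodesic (hA : A.PosDef) (hB : B.PosDef) :
    IsPosCurve A B (posGeodesic A B) := by
  have h := ((hA.conj_cfcRpow hB (-(1 / 2))).isPosCurve_cfcRpow).conj (hA.isUnit_cfcRpow (1 / 2))
  rw [star_cfcRpow, mul_one, hA.cfcRpow_half_mul_self, hA.conj_conj_cfcRpow] at h
  exact h

theorem PosDef.posDef_posGeodesic (hA : A.PosDef) (hB : B.PosDef) (s : ℝ) :
    (posGeodesic A B s).PosDef :=
  hA.conj_cfcRpow ((hA.conj_cfcRpow hB _).cfcRpow s) _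

theorem PosDef.finslerLength_posGeodesic (hN : IsUnitarilyInvariantNorm N) (hA : A.PosDef)
    (hB : B.PosDef) : finslerLength N (posGeodesic A B) =
      N (CFC.log (A ^ (-(1 / 2) : ℝ) * B * A ^ (-(1 / 2) : ℝ))) := by
  have hM := hA.conj_cfcRpow hB (-(1 / 2))
  rw [posGeodesic_eq_conj, hM.isPosCurve_cfcRpow.finslerLength_conj hN
    (hA.isUnit_cfcRpow _), hM.finslerLength_cfcRpow]

end Matrix

theorem finslerLength_nonneg {n : ℕ} (N : Seminorm ℂ (Matrix (Fin n) (Fin n) ℂ))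
    (α : ℝ → Matrix (Fin n) (Fin n) ℂ) : 0 ≤ finslerLength N α :=
  intervalIntegral.integral_nonneg zero_le_one fun _ _ => apply_nonneg N _

/-! ### The distance formula and its consequences. -/

namespace IsUnitarilyInvariantNorm

open Matrix

variable {n : ℕ} {N : Seminorm ℂ (Matrix (Fin n) (Fin n) ℂ)} {A B C : Matrix (Fin n) (Fin n) ℂ}
  {T : Matrix (Fin n) (Fin n) ℂ}

/-- The geodesics of the space of positive definite matrices are shortest curves. -/
theorem finslerDist_eq (hN : IsUnitarilyInvariantNorm N) (hA : A.PosDef) (hB : B.PosDef) :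
    finslerDist N A B = N (CFC.log (A ^ (-(1 / 2) : ℝ) * B * A ^ (-(1 / 2) : ℝ))) := by
  refine le_antisymm ?_ ?_
  · rw [← hA.finslerLength_posGeodesic hN hB]
    refine csInf_le ⟨0, ?_⟩ ⟨_, hA.isPosCurve_posGeodesic hB, rfl⟩
    rintro _ ⟨α, -, rfl⟩
    exact finslerLength_nonneg N α
  · refine le_csInf ⟨_, _, hA.isPosCurve_posGeodesic hB, rfl⟩ ?_
    rintro _ ⟨α, hα, rfl⟩
    -- Congruence by A^{-1/2} moves the starting point to 1, where the logarithm vanishes, so the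
    -- growth bound becomes a lower bound for the length.
    have hT := hA.isUnit_cfcRpow (-(1 / 2))
    have h := (hα.conj hT).map_log_le hN
    rw [hα.finslerLength_conj hN hT, star_cfcRpow] at h
    rwa [hA.cfcRpow_neg_half_conj_self, CFC.log_one, map_zero, zero_add] at h

theorem finslerDist_one_left (hN : IsUnitarilyInvariantNorm N) (hA : A.PosDef) :
    finslerDist N 1 A = N (CFC.log A) := by
  rw [hN.finslerDist_eq .one hA, CFC.one_rpow, one_mul, mul_one]

theorem finslerDist_conj (hN : IsUnitarilyInvariantNorm N) (hA : A.PosDef) (hB : B.PosDef)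
    (hT : IsUnit T) : finslerDist N (T * A * star T) (T * B * star T) = finslerDist N A B := by
  rw [hN.finslerDist_eq (hA.conj hT) (hB.conj hT), hN.map_log_conj_cfcRpow hA hB hT,
    hN.finslerDist_eq hA hB]

/-- Congruence by A^{1/2} takes the pair (M, 1) to (B, A), and log M⁻¹ = -log M. -/
theorem finslerDist_comm (hN : IsUnitarilyInvariantNorm N) (hA : A.PosDef) (hB : B.PosDef) :
    finslerDist N A B = finslerDist N B A := by
  have hM := hA.conj_cfcRpow hB (-(1 / 2))
  have hconj := hN.finslerDist_conj hM .one (hA.isUnit_cfcRpow (1 / 2))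
  rw [star_cfcRpow, hA.conj_conj_cfcRpow, mul_one, hA.cfcRpow_half_mul_self,
    hN.finslerDist_eq hM .one, mul_one, ← hM.cfcRpow_add, hM.log_cfcRpow] at hconj
  rw [hconj, hN.finslerDist_eq hA hB]
  norm_num

theorem map_log_le_add_finslerDist (hN : IsUnitarilyInvariantNorm N) (hA : A.PosDef)
    (hB : B.PosDef) : N (CFC.log B) ≤ N (CFC.log A) + finslerDist N A B := by
  rw [hN.finslerDist_eq hA hB, ← hA.finslerLength_posGeodesic hN hB]
  exact (hA.isPosCurve_posGeodesic hB).map_log_le hN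

theorem finslerDist_one_le_add (hN : IsUnitarilyInvariantNorm N) (hA : A.PosDef)
    (hB : B.PosDef) : finslerDist N 1 B ≤ finslerDist N 1 A + finslerDist N A B := by
  rw [hN.finslerDist_one_left hA, hN.finslerDist_one_left hB]
  exact hN.map_log_le_add_finslerDist hA hB

end IsUnitarilyInvariantNorm

/-- A continuous midpoint convex function is convex. -/
theorem ContinuousOn.convexOn_of_midpoint {f : ℝ → ℝ} {s : Set ℝ} (hs : Convex ℝ s)
    (hf : ContinuousOn f s)
    (hmid : ∀ x ∈ s, ∀ y ∈ s, f ((x + y) / 2) ≤ (f x + f y) / 2) : ConvexOn ℝ s f := by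
  refine ⟨hs, fun x hx y hy p q hp hq hpq => ?_⟩
  have hmem : ∀ u ∈ Icc (0 : ℝ) 1, (1 - u) * x + u * y ∈ s := fun u hu =>
    hs hx hy (sub_nonneg.2 hu.2) hu.1 (by ring)
  let g : ℝ → ℝ := fun u => f ((1 - u) * x + u * y) - ((1 - u) * f x + u * f y)
  have hg : ContinuousOn g (Icc 0 1) := by
    refine ContinuousOn.sub (hf.comp (by fun_prop) hmem) (by fun_prop)
  have hgmid : ∀ u ∈ Icc (0 : ℝ) 1, ∀ v ∈ Icc (0 : ℝ) 1, g ((u + v) / 2) ≤ (g u + g v) / 2 := by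
    intro u hu v hv
    have h := hmid _ (hmem u hu) _ (hmem v hv)
    have he : ((1 - u) * x + u * y + ((1 - v) * x + v * y)) / 2 =
        (1 - (u + v) / 2) * x + (u + v) / 2 * y := by ring
    rw [he] at h
    simp only [g]
    linarith
  obtain ⟨m, hm, hmax⟩ := isCompact_Icc.exists_isMaxOn (nonempty_Icc.2 zero_le_one) hg
  have hg0 : g 0 = 0 := by simp [g]
  have hg1 : g 1 = 0 := by simp [g]
  have hle : g m ≤ 0 := by
    by_contra! hpos
    have hclosed : IsCompact (Icc (0 : ℝ) 1 ∩ g ⁻¹' {g m}) :=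
      isCompact_Icc.of_isClosed_subset
        (hg.preimage_isClosed_of_isClosed isClosed_Icc isClosed_singleton) inter_subset_left
    -- Take the leftmost maximum of the deviation `g` from the chord. If the maximum is positive,
    -- this point is interior, and midpoint convexity makes `l - ε` a maximum as well.
    obtain ⟨l, ⟨hl, hgl⟩, hleast⟩ := hclosed.exists_isLeast ⟨m, hm, rfl⟩
    rw [mem_preimage, mem_singleton_iff] at hgl
    have hl0 : 0 < l := lt_of_le_of_ne hl.1 (by rintro rfl; linarith)
    have hl1 : l < 1 := lt_of_le_of_ne hl.2 (by rintro rfl; linarith)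
    set ε := min l (1 - l) with hε
    have hε0 : 0 < ε := lt_min hl0 (by linarith)
    have hεl : ε ≤ l := min_le_left _ _
    have hεr : ε ≤ 1 - l := min_le_right _ _
    have ha : l - ε ∈ Icc (0 : ℝ) 1 := ⟨by linarith, by linarith⟩
    have hb : l + ε ∈ Icc (0 : ℝ) 1 := ⟨by linarith, by linarith⟩
    have h := hgmid _ ha _ hb
    rw [show (l - ε + (l + ε)) / 2 = l by ring, hgl] at h
    have h1 : g (l - ε) ≤ g m := hmax ha
    have h2 : g (l + ε) ≤ g m := hmax hb
    have h3 : l ≤ l - ε := hleast ⟨ha, by rw [mem_preimage, mem_singleton_iff]; linarith⟩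
    linarith
  have hq1 : q ∈ Icc (0 : ℝ) 1 := ⟨hq, by linarith⟩
  have hgq : g q ≤ 0 := (hmax hq1).trans hle
  obtain rfl : p = 1 - q := by linarith
  simp only [smul_eq_mul]
  simp only [g] at hgq
  linarith

/-! ### Point reflections and convexity of the distance along geodesics. -/

namespace Matrix

variable {n : ℕ} {A B T : Matrix (Fin n) (Fin n) ℂ}

theorem PosDef.posGeodesic_conj (hA : A.PosDef) (hB : B.PosDef) (hT : IsUnit T) (s : ℝ) :
    posGeodesic (T * A * star T) (T * B * star T) s = T * posGeodesic A B s * star T := by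
  obtain ⟨U, hU, h1, h2⟩ := hA.exists_unitary_of_conj hT
  have h1' := congrArg star h1
  have h2' := congrArg star h2
  simp only [star_mul, star_cfcRpow] at h1' h2'
  have hM : (T * A * star T) ^ (-(1 / 2) : ℝ) * (T * B * star T) *
      (T * A * star T) ^ (-(1 / 2) : ℝ) =
      U * (A ^ (-(1 / 2) : ℝ) * B * A ^ (-(1 / 2) : ℝ)) * star U := by
    calc _ = ((T * A * star T) ^ (-(1 / 2) : ℝ) * T) * B *
          (star T * (T * A * star T) ^ (-(1 / 2) : ℝ)) := by simp only [mul_assoc]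
      _ = _ := by rw [h2, h2']; simp only [mul_assoc]
  rw [posGeodesic, hM, PosDef.cfcRpow_unitary_conj hU (hA.conj_cfcRpow hB _)]
  calc _ = ((T * A * star T) ^ (1 / 2 : ℝ) * U) *
        (A ^ (-(1 / 2) : ℝ) * B * A ^ (-(1 / 2) : ℝ)) ^ s *
        (star U * (T * A * star T) ^ (1 / 2 : ℝ)) := by simp only [mul_assoc]
    _ = _ := by rw [h1, h1', posGeodesic]; simp only [mul_assoc]

/-- The point reflection at the midpoint interchanges the end points of a geodesic segment. -/
theorem PosDef.posGeodesic_reflection (hA : A.PosDef) (hB : B.PosDef) (x y : ℝ) :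
    posGeodesic A B ((x + y) / 2) * posGeodesic A B x ^ (-1 : ℝ) * posGeodesic A B ((x + y) / 2) =
      posGeodesic A B y := by
  have hM := hA.conj_cfcRpow hB (-(1 / 2))
  have hX := hA.posDef_posGeodesic hB x
  have hG := hA.posDef_posGeodesic hB ((x + y) / 2)
  set M := A ^ (-(1 / 2) : ℝ) * B * A ^ (-(1 / 2) : ℝ) with hMdef
  have hγ : ∀ s, posGeodesic A B s = A ^ (1 / 2 : ℝ) * M ^ s * A ^ (1 / 2 : ℝ) := fun s => rfl
  have hAA := hA.cfcRpow_mul_cfcRpow_neg (1 / 2)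
  have hAA' := hA.cfcRpow_neg_mul_cfcRpow (1 / 2)
  have hinv : posGeodesic A B x ^ (-1 : ℝ) =
      A ^ (-(1 / 2) : ℝ) * M ^ (-x) * A ^ (-(1 / 2) : ℝ) := by
    have h1 : posGeodesic A B x * posGeodesic A B x ^ (-1 : ℝ) = 1 := by
      nth_rewrite 1 [← hX.cfcRpow_one]
      exact hX.cfcRpow_mul_cfcRpow_neg 1
    have h2 : A ^ (-(1 / 2) : ℝ) * M ^ (-x) * A ^ (-(1 / 2) : ℝ) * posGeodesic A B x = 1 := by
      calc _ = A ^ (-(1 / 2) : ℝ) * (M ^ (-x) * ((A ^ (-(1 / 2) : ℝ) * A ^ (1 / 2 : ℝ)) * M ^ x)) *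
            A ^ (1 / 2 : ℝ) := by rw [hγ]; simp only [mul_assoc]
        _ = 1 := by rw [hAA', one_mul, hM.cfcRpow_neg_mul_cfcRpow, mul_one, hAA']
    exact (left_inv_eq_right_inv h2 h1).symm
  rw [hinv, hγ, hγ]
  calc _ = A ^ (1 / 2 : ℝ) * (M ^ ((x + y) / 2) * ((A ^ (1 / 2 : ℝ) * A ^ (-(1 / 2) : ℝ)) *
        (M ^ (-x) * ((A ^ (-(1 / 2) : ℝ) * A ^ (1 / 2 : ℝ)) * M ^ ((x + y) / 2))))) *
        A ^ (1 / 2 : ℝ) := by simp only [mul_assoc]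
    _ = A ^ (1 / 2 : ℝ) * M ^ y * A ^ (1 / 2 : ℝ) := by
      rw [hAA, hAA', one_mul, one_mul, ← hM.cfcRpow_add, ← hM.cfcRpow_add]
      congr 3
      ring

end Matrix

namespace IsUnitarilyInvariantNorm

open Matrix

variable {n : ℕ} {N : Seminorm ℂ (Matrix (Fin n) (Fin n) ℂ)} {A B P : Matrix (Fin n) (Fin n) ℂ}

/-- The relation `h` says that V = X^{-1/2} G Y^{-1/2} is unitary, and V Y V* = X^{-1/2} G²
X^{-1/2}. So N(log Y) is the distance from X to G², and the growth bound from X to G² gives twice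
the claim. -/
theorem map_log_midpoint_le (hN : IsUnitarilyInvariantNorm N) {X Y G : Matrix (Fin n) (Fin n) ℂ}
    (hX : X.PosDef) (hY : Y.PosDef) (hG : G.PosDef) (h : G * X ^ (-1 : ℝ) * G = Y) :
    N (CFC.log G) ≤ (N (CFC.log X) + N (CFC.log Y)) / 2 := by
  let V := X ^ (-(1 / 2) : ℝ) * G * Y ^ (-(1 / 2) : ℝ)
  have hGs : star G = G := hG.isHermitian
  have hVs : star V = Y ^ (-(1 / 2) : ℝ) * G * X ^ (-(1 / 2) : ℝ) := by
    simp only [V, star_mul, star_cfcRpow, hGs, mul_assoc]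
  have hYY := hY.cfcRpow_neg_half_conj_self
  have hXX : X ^ (-(1 / 2) : ℝ) * X ^ (-(1 / 2) : ℝ) = X ^ (-1 : ℝ) := by
    rw [← hX.cfcRpow_add]
    norm_num
  have hV : V ∈ unitaryGroup (Fin n) ℂ := by
    rw [mem_unitaryGroup_iff', hVs]
    calc _ = Y ^ (-(1 / 2) : ℝ) * (G * (X ^ (-(1 / 2) : ℝ) * X ^ (-(1 / 2) : ℝ)) * G) *
          Y ^ (-(1 / 2) : ℝ) := by simp only [V, mul_assoc]
      _ = 1 := by rw [hXX, h, hYY]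
  have hYY' : Y ^ (-(1 / 2) : ℝ) * (Y * Y ^ (-(1 / 2) : ℝ)) = 1 := by rw [← mul_assoc, hYY]
  have hVY : V * Y * star V = X ^ (-(1 / 2) : ℝ) * (G ^ (2 : ℝ)) * X ^ (-(1 / 2) : ℝ) := by
    have hG2 : G ^ (2 : ℝ) = G * G := by
      rw [← one_add_one_eq_two, hG.cfcRpow_add, hG.cfcRpow_one]
    calc _ = X ^ (-(1 / 2) : ℝ) * G * (Y ^ (-(1 / 2) : ℝ) * (Y * Y ^ (-(1 / 2) : ℝ))) * G *
          X ^ (-(1 / 2) : ℝ) := by rw [hVs]; simp only [V, mul_assoc]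
      _ = _ := by rw [hYY', mul_one, hG2, mul_assoc _ G G]
  have hmain := hN.map_log_le_add_finslerDist hX (hG.cfcRpow 2)
  rw [hN.finslerDist_eq hX (hG.cfcRpow 2), ← hVY, log_unitary_conj hV hY.isHermitian,
    hN.map_unitary_conj hV, hG.log_cfcRpow, ← Complex.coe_smul, map_smul_eq_mul] at hmain
  norm_num at hmain
  linarith

theorem convexOn_finslerDist_one (hN : IsUnitarilyInvariantNorm N) (hA : A.PosDef)
    (hB : B.PosDef) :
    ConvexOn ℝ (Icc (0 : ℝ) 1) fun s => finslerDist N 1 (posGeodesic A B s) := by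
  have hpos := hA.posDef_posGeodesic hB
  simp only [hN.finslerDist_one_left (hpos _)]
  refine ContinuousOn.convexOn_of_midpoint (convex_Icc 0 1) ?_ fun x _ y _ =>
    hN.map_log_midpoint_le (hpos x) (hpos y) (hpos _) (hA.posGeodesic_reflection hB x y)
  exact N.continuous_matrix.comp_continuousOn
    (continuousOn_log.comp (hA.isPosCurve_posGeodesic hB).continuousOn fun s _ => hpos s)

/-- Congruence by P^{-1/2} is an isometry that maps geodesics to geodesics and P to 1. -/
theorem convexOn_finslerDist (hN : IsUnitarilyInvariantNorm N) (hP : P.PosDef) (hA : A.PosDef)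
    (hB : B.PosDef) :
    ConvexOn ℝ (Icc (0 : ℝ) 1) fun s => finslerDist N P (posGeodesic A B s) := by
  have hT := hP.isUnit_cfcRpow (-(1 / 2))
  have h := hN.convexOn_finslerDist_one (hA.conj hT) (hB.conj hT)
  have hPP : P ^ (-(1 / 2) : ℝ) * P * star (P ^ (-(1 / 2) : ℝ)) = 1 := by
    rw [star_cfcRpow, hP.cfcRpow_neg_half_conj_self]
  simpa only [hA.posGeodesic_conj hB hT, ← hPP,
    hN.finslerDist_conj hP (hA.posDef_posGeodesic hB _) hT] using h

end IsUnitarilyInvariantNorm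

/-! ### Geodesic convexity of the sets of intermediate points. -/

theorem ConvexOn.le_of_endpoints_le {f : ℝ → ℝ} (hf : ConvexOn ℝ (Icc 0 1) f) {c : ℝ}
    (h0 : f 0 ≤ c) (h1 : f 1 ≤ c) {s : ℝ} (hs : s ∈ Icc (0 : ℝ) 1) : f s ≤ c := by
  have h := hf.le_max_of_mem_Icc (left_mem_Icc.2 zero_le_one) (right_mem_Icc.2 zero_le_one) hs
  exact h.trans (max_le h0 h1)

theorem mainTheorem9 (n : ℕ) (N : Seminorm ℂ (Matrix (Fin n) (Fin n) ℂ))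
    (hN : IsUnitarilyInvariantNorm N) :
    (∀ A B : Matrix (Fin n) (Fin n) ℂ, A.PosDef → B.PosDef →
      ConvexOn ℝ (Set.Icc (0 : ℝ) 1) (fun s => finslerDist N 1 (posGeodesic A B s))) ∧
    (∀ P : Matrix (Fin n) (Fin n) ℂ, P.PosDef → ∀ t ∈ Set.Ioo (0 : ℝ) 1,
      GeodesicallyConvex (intermediatePoints N 1 P t)) := by
  refine ⟨fun A B hA hB => hN.convexOn_finslerDist_one hA hB, fun P hP t _ =>
    ⟨fun W hW => hW.1, ?_⟩⟩
  rintro W₀ ⟨hW₀, h₀, h₀'⟩ W₁ ⟨hW₁, h₁, h₁'⟩ s hs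
  have hW := hW₀.posDef_posGeodesic hW₁ s
  have hγ := hW₀.isPosCurve_posGeodesic hW₁
  rw [hN.finslerDist_comm hW₀ hP] at h₀'
  rw [hN.finslerDist_comm hW₁ hP] at h₁'
  have hle : finslerDist N 1 (posGeodesic W₀ W₁ s) ≤ t * finslerDist N 1 P :=
    (hN.convexOn_finslerDist_one hW₀ hW₁).le_of_endpoints_le
      (by rw [hγ.source, h₀]) (by rw [hγ.target, h₁]) hs
  have hle' : finslerDist N P (posGeodesic W₀ W₁ s) ≤ (1 - t) * finslerDist N 1 P :=
    (hN.convexOn_finslerDist hP hW₀ hW₁).le_of_endpoints_le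
      (by rw [hγ.source, h₀']) (by rw [hγ.target, h₁']) hs
  rw [← hN.finslerDist_comm hW hP] at hle'
  -- The two upper bounds add up to d_N(1, P), so the triangle inequality forces equality in both.
  have htri := hN.finslerDist_one_le_add hW hP
  exact ⟨hW, by linarith, by linarith⟩
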